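/- Let $A$ be a (not necessarily unital) $C^*$-algebra and let $E$ be a Hilbert $C^*$-module over $A$. Let $L(E)$ be the algebra of bounded adjointable operators on $E$, and let $K(E)\subseteq L(E)$ be the compact operators, i.e. the norm closure of the linear span of the rank one operators $\theta_{x,y}\colon z\mapsto x\langle y,z\rangle$. A \emph{regular} operator on $E$ is a closed densely defined $A$-linear operator $t\colon D(t)\subseteq E\to E$ whose adjoint $t^*$ is densely defined and for which $1+t^*t$ has dense range; it is \emph{selfadjoint} if $t=t^*$. A regular operator $t$ is \emph{Fredholm} if there are $G,G'\in L(E)$ such that $Gt$ and $tG'$ are closable and their closures belong to $L(E)$ and are congruent to $1$ modulo $K(E)$. Let $t$ be a selfadjoint regular Fredholm operator on $E$. Then there exists $\varepsilon>0$ with the following property: whenever $s\colon D(s)\subseteq E\to E$ is a selfadjoint regular operator with $D(t)\subseteq D(s)$ and $$\|s x\|\le \varepsilon\,\bigl(\|(t+s)x\|+\|x\|\bigr)\qquad\text{for all }x\in D(t),$$ the operator $t+s$ (with domain $D(t)$) is a selfadjoint regular Fredholm operator on $E$. -/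

import Mathlib

namespace HilbertCStarModule

section Operators

variable (A : Type*) {E : Type*} [NonUnitalCStarAlgebra A] [PartialOrder A]
  [NormedAddCommGroup E] [NormedSpace ℂ E] [SMul A E] [CStarModule A E]

/-! ### Bounded adjointable operators and compact operators -/

/-- A bounded operator `T` on `E` is adjointable if there is a bounded operator `S` with
`⟪T x, y⟫ = ⟪x, S y⟫` for all `x, y`. The adjointable operators form `L(E)`. -/
def IsAdjointable (T : E →L[ℂ] E) : Prop :=
  ∃ S : E →L[ℂ] E, ∀ x y : E, inner A (T x) y = inner A x (S y)

variable {A} in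
theorem ext_inner {x y : E} (h : ∀ z : E, inner A z x = inner A z y) : x = y := by
  rw [← sub_eq_zero, ← CStarModule.inner_self (A := A), CStarModule.inner_sub_right, h, sub_self]

theorem norm_smul_le (a : A) (x : E) : ‖a • x‖ ≤ ‖a‖ * ‖x‖ := by
  refine le_of_sq_le_sq ?_ (by positivity)
  rw [CStarModule.norm_sq_eq A, mul_pow, CStarModule.norm_sq_eq A (x := x)]
  rw [CStarModule.inner_op_smul_left, CStarModule.inner_op_smul_right]
  calc ‖a * inner A x x * star a‖ ≤ ‖a‖ * ‖inner A x x‖ * ‖star a‖ :=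
        (norm_mul_le _ _).trans (by gcongr; exact norm_mul_le _ _)
    _ = ‖a‖ ^ 2 * ‖inner A x x‖ := by rw [norm_star]; ring

variable [StarOrderedRing A]

/-- The rank one operator `z ↦ ⟪y, z⟫ • x`. (In Mathlib's convention the inner product is
`A`-linear in its second variable and the scalars from `A` are written on the left.) -/
noncomputable def rankOne (x y : E) : E →L[ℂ] E :=
  LinearMap.mkContinuous
    { toFun := fun z => inner A y z • x
      map_add' := fun z w => ext_inner (A := A) fun v => by simp [add_mul]
      map_smul' := fun c z => ext_inner (A := A) fun v => by simp [smul_mul_assoc] }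
    (‖x‖ * ‖y‖) fun z => by
      refine (norm_smul_le A _ _).trans ?_
      have h : ‖inner A y z‖ ≤ ‖y‖ * ‖z‖ := CStarModule.norm_inner_le E
      calc ‖inner A y z‖ * ‖x‖ ≤ (‖y‖ * ‖z‖) * ‖x‖ := by gcongr
        _ = ‖x‖ * ‖y‖ * ‖z‖ := by ring

variable (E) in
/-- `K(E)`: the norm closure of the linear span of the rank one operators. -/
noncomputable def compactOperators : Submodule ℂ (E →L[ℂ] E) :=
  (Submodule.span ℂ {T | ∃ x y : E, T = rankOne A x y}).topologicalClosure

/-! ### Unbounded operators -/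

/-- The composition `g f` of partially defined operators, with domain
`{x ∈ D(f) | f x ∈ D(g)}`. -/
def pcomp (g f : E →ₗ.[ℂ] E) : E →ₗ.[ℂ] E where
  domain := (g.domain.comap f.toFun).map f.domain.subtype
  toFun :=
    { toFun := fun x => g ⟨f ⟨x, by obtain ⟨y, -, h⟩ := x.2; exact h ▸ y.2⟩, by
        obtain ⟨_, y, hy, rfl⟩ := x
        exact hy⟩
      map_add' := fun x y => by rw [← g.map_add]; congr 1; ext; exact f.map_add ⟨x, _⟩ ⟨y, _⟩
      map_smul' := fun c x => by
        rw [RingHom.id_apply, ← g.map_smul]; congr 1; ext; exact f.map_smul c ⟨x, _⟩ }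

theorem mem_pcomp_domain {g f : E →ₗ.[ℂ] E} {x : E} :
    x ∈ (pcomp g f).domain ↔ ∃ h : x ∈ f.domain, f ⟨x, h⟩ ∈ g.domain := by
  constructor
  · rintro ⟨y, hy, rfl⟩
    exact ⟨y.2, hy⟩
  · rintro ⟨h, h'⟩
    exact ⟨⟨x, h⟩, h', rfl⟩

theorem pcomp_apply {g f : E →ₗ.[ℂ] E} {x : E} (h : x ∈ f.domain) (h' : f ⟨x, h⟩ ∈ g.domain) :
    pcomp g f ⟨x, mem_pcomp_domain.2 ⟨h, h'⟩⟩ = g ⟨f ⟨x, h⟩, h'⟩ := rfl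

/-- The graph of the adjoint: all pairs `(y, z)` with `⟪t x, y⟫ = ⟪x, z⟫` for all `x ∈ D(t)`. -/
def adjointGraph (t : E →ₗ.[ℂ] E) : Submodule ℂ (E × E) where
  carrier := {p | ∀ x : t.domain, inner A (t x) p.1 = inner A (x : E) p.2}
  add_mem' := fun hp hq x => by simp [hp x, hq x]
  zero_mem' := fun x => by simp
  smul_mem' := fun c p hp x => by simp [hp x]

/-- The adjoint `t*` of `t`, with domain the set of all `y` for which some `z` satisfies
`⟪t x, y⟫ = ⟪x, z⟫` for all `x ∈ D(t)`, and then `t* y = z`. This is only used when `t` is densely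
defined, so that `z` is unique. -/
noncomputable def adjoint (t : E →ₗ.[ℂ] E) : E →ₗ.[ℂ] E :=
  (adjointGraph A t).toLinearPMap

theorem graph_adjoint {t : E →ₗ.[ℂ] E} (ht : Dense (t.domain : Set E)) :
    (adjoint A t).graph = adjointGraph A t := by
  refine Submodule.toLinearPMap_graph_eq _ fun p hp h0 => ?_
  have hc : Continuous fun x : E => inner A x p.2 :=
    (CStarModule.continuous_inner (A := A)).comp (continuous_id.prodMk continuous_const)
  have h : (fun x : E => inner A x p.2) = fun _ => (0 : A) := by
    refine Continuous.ext_on ht hc continuous_const fun x hx => ?_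
    have := hp ⟨x, hx⟩
    rw [h0, CStarModule.inner_zero_right] at this
    exact this.symm
  exact (CStarModule.inner_self (A := A)).1 (congrFun h p.2)

/-- `t` is `A`-linear: its domain is an `A`-submodule and `t (a x) = a (t x)` on it. -/
def IsModuleMap (t : E →ₗ.[ℂ] E) : Prop :=
  ∀ (a : A) (x : t.domain), ∃ h : a • (x : E) ∈ t.domain, t ⟨a • (x : E), h⟩ = a • t x

/-- A regular operator: a closed, densely defined (`A`-linear) operator `t` with densely defined
adjoint such that `1 + t* t` has dense range. -/
structure IsRegular (t : E →ₗ.[ℂ] E) : Prop where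
  isModuleMap : IsModuleMap A t
  isClosed : t.IsClosed
  dense_domain : Dense (t.domain : Set E)
  dense_adjoint_domain : Dense ((adjoint A t).domain : Set E)
  dense_range : Dense (Set.range fun x : (pcomp (adjoint A t) t).domain =>
    (x : E) + pcomp (adjoint A t) t x)

/-- A selfadjoint regular operator: a regular operator with `t* = t`. -/
structure IsSelfAdjointRegular (t : E →ₗ.[ℂ] E) : Prop where
  isRegular : IsRegular A t
  adjoint_eq : adjoint A t = t

/-- `u` is closable, its closure is (everywhere defined and) a bounded adjointable operator, and
this operator is congruent to `1` modulo the compact operators. -/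
def ClosureEqOneModCompact (u : E →ₗ.[ℂ] E) : Prop :=
  u.IsClosable ∧ ∃ T : E →L[ℂ] E, IsAdjointable A T ∧
    u.closure = (T : E →ₗ[ℂ] E).toPMap ⊤ ∧ T - 1 ∈ compactOperators A E

/-- `G ∈ L(E)` is a pseudo left inverse of `t`: the closure of `G t` is in `1 + K(E)`. -/
def IsPseudoLeftInverse (G : E →L[ℂ] E) (t : E →ₗ.[ℂ] E) : Prop :=
  IsAdjointable A G ∧ ClosureEqOneModCompact A (pcomp ((G : E →ₗ[ℂ] E).toPMap ⊤) t)

/-- `G ∈ L(E)` is a pseudo right inverse of `t`: the closure of `t G` is in `1 + K(E)`. -/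
def IsPseudoRightInverse (G : E →L[ℂ] E) (t : E →ₗ.[ℂ] E) : Prop :=
  IsAdjointable A G ∧ ClosureEqOneModCompact A (pcomp t ((G : E →ₗ[ℂ] E).toPMap ⊤))

/-- A Fredholm operator: a regular operator with a pseudo left and a pseudo right inverse. -/
structure IsFredholm (t : E →ₗ.[ℂ] E) : Prop where
  isRegular : IsRegular A t
  exists_left : ∃ G : E →L[ℂ] E, IsPseudoLeftInverse A G t
  exists_right : ∃ G : E →L[ℂ] E, IsPseudoRightInverse A G t

end Operators

end HilbertCStarModule

/-! For small `ε`, the term `s x` on the right of the bound can be absorbed, so `s` is bounded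
relative to `t` with a small constant `δ`.

Selfadjointness is Kato–Rellich. The operators `t ± i` are bijective on the domain of `t`, with
`‖x‖, ‖t x‖ ≤ ‖(t ± i) x‖`, so `s (t ± i)⁻¹` has norm at most `2δ < 1`. Then `t + s ± i = (1 + s (t
± i)⁻¹)(t ± i)` is surjective, which for a densely defined symmetric module map gives
selfadjointness and regularity (`IsSymm.isSelfAdjointRegular`).

For the Fredholm property, let `G` be a pseudo right inverse of `t`. Since `t` is closed, `T = t G`
is everywhere defined and lies in `1 + K(E)`. For small `δ`, `S = s G` is adjointable with `‖S‖ <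
1`. With `V = (1 + S)⁻¹` one gets `(t + s) G V = (T + S) V = 1 + (T - 1) V`, so `G V` is a pseudo
right inverse; by symmetry its adjoint is a pseudo left inverse. -/

namespace HilbertCStarModule

open CStarModule

section Lemmas

variable {A E : Type*} [NonUnitalCStarAlgebra A] [PartialOrder A]
  [NormedAddCommGroup E] [NormedSpace ℂ E] [SMul A E] [CStarModule A E]

/-! ### Pairs of mutually adjoint bounded operators -/

variable (A) in
/-- `S` is the adjoint of the bounded operator `T`. -/
def AdjointPair (T S : E →L[ℂ] E) : Prop :=
  ∀ x y : E, inner A (T x) y = inner A x (S y)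

namespace AdjointPair

variable {T S T' S' : E →L[ℂ] E}

theorem symm (h : AdjointPair A T S) : AdjointPair A S T := fun x y => by
  rw [← star_inner, ← h, star_inner]

theorem one : AdjointPair A (1 : E →L[ℂ] E) 1 := fun _ _ => rfl

theorem zero : AdjointPair A (0 : E →L[ℂ] E) 0 := fun _ _ => by simp

theorem add (h : AdjointPair A T S) (h' : AdjointPair A T' S') :
    AdjointPair A (T + T') (S + S') := fun x y => by simp [h x y, h' x y]

theorem sub (h : AdjointPair A T S) (h' : AdjointPair A T' S') :
    AdjointPair A (T - T') (S - S') := fun x y => by simp [h x y, h' x y]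

theorem smul (c : ℂ) (h : AdjointPair A T S) : AdjointPair A (c • T) (star c • S) :=
  fun x y => by simp [h x y]

theorem mul (h : AdjointPair A T S) (h' : AdjointPair A T' S') :
    AdjointPair A (T * T') (S' * S) := fun x y => by
  rw [mul_apply_eq_comp, h, h', mul_apply_eq_comp]

/-- Inverses of mutually adjoint operators are mutually adjoint. -/
theorem of_inverse (h : AdjointPair A T S) (hT : T * T' = 1) (hS : S * S' = 1) :
    AdjointPair A T' S' := fun x y => by
  have h1 : T (T' x) = x := congr($hT x)
  have h2 : S (S' y) = y := congr($hS y)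
  calc inner A (T' x) y = inner A (T' x) (S (S' y)) := by rw [h2]
    _ = inner A x (S' y) := by rw [← h, h1]

theorem isAdjointable (h : AdjointPair A T S) : IsAdjointable A T := ⟨S, h⟩

end AdjointPair

theorem norm_le_of_norm_inner_le {C : ℝ} (hC : 0 ≤ C) {z : E}
    (h : ‖inner A z z‖ ≤ C * ‖z‖) : ‖z‖ ≤ C := by
  rw [← norm_sq_eq A, sq] at h
  rcases (norm_nonneg z).eq_or_lt with h0 | h0
  · rwa [← h0]
  · exact le_of_mul_le_mul_right h h0

/-! ### Symmetric operators and sums -/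

variable (A) in
/-- `t` is symmetric: `⟪t x, y⟫ = ⟪x, t y⟫` on its domain. -/
def IsSymm (t : E →ₗ.[ℂ] E) : Prop :=
  ∀ x y : t.domain, inner A (t x) (y : E) = inner A (x : E) (t y)

/-- The hypotheses on `c` treat `i` and `-i` together; symmetry cancels the cross terms. -/
theorem IsSymm.inner_self_add_smul {t : E →ₗ.[ℂ] E} (ht : IsSymm A t) {c : ℂ}
    (hc : star c = -c) (hc2 : c * c = -1) (x : t.domain) :
    inner A (t x + c • (x : E)) (t x + c • (x : E)) =
      inner A (t x) (t x) + inner A (x : E) (x : E) := by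
  have hcc : ∀ a : A, c • c • a = -a := fun a => by rw [smul_smul, hc2, neg_one_smul]
  simp only [CStarModule.inner_add_left, CStarModule.inner_add_right, inner_smul_left_complex,
    inner_smul_right_complex, hc, ht x x, neg_smul, smul_add, smul_neg, hcc]
  abel

theorem IsModuleMap.add {t s : E →ₗ.[ℂ] E} (ht : IsModuleMap A t) (hs : IsModuleMap A s) :
    IsModuleMap A (t + s) := by
  rintro a ⟨x, hxt, hxs⟩
  obtain ⟨h1, h2⟩ := ht a ⟨x, hxt⟩
  obtain ⟨h3, h4⟩ := hs a ⟨x, hxs⟩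
  refine ⟨⟨h1, h3⟩, ?_⟩
  rw [LinearPMap.add_apply, LinearPMap.add_apply, h2, h4]
  exact ext_inner (A := A) fun z => by
    simp only [CStarModule.inner_add_right, inner_op_smul_right, mul_add]

theorem IsSymm.add {t s : E →ₗ.[ℂ] E} (ht : IsSymm A t) (hs : IsSymm A s) :
    IsSymm A (t + s) := fun x y => by
  rw [LinearPMap.add_apply, LinearPMap.add_apply, CStarModule.inner_add_left, CStarModule.inner_add_right,
    ← ht ⟨x, x.2.1⟩ ⟨y, y.2.1⟩, ← hs ⟨x, x.2.2⟩ ⟨y, y.2.2⟩]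

variable [StarOrderedRing A]

namespace AdjointPair

variable {T S : E →L[ℂ] E}

/-- Cauchy–Schwarz applied to `⟪S y, S y⟫ = ⟪T (S y), y⟫`. This carries norm approximations over to
adjoints. -/
theorem norm_le (h : AdjointPair A T S) : ‖S‖ ≤ ‖T‖ := by
  refine S.opNorm_le_bound (norm_nonneg _) fun y => ?_
  refine norm_le_of_norm_inner_le (A := A) (by positivity) ?_
  rw [← h]
  calc ‖inner A (T (S y)) y‖ ≤ ‖T (S y)‖ * ‖y‖ := norm_inner_le E
    _ ≤ ‖T‖ * ‖S y‖ * ‖y‖ := by gcongr; exact T.le_opNorm _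
    _ = ‖T‖ * ‖y‖ * ‖S y‖ := by ring

end AdjointPair

/-! ### Compact operators -/

theorem adjointPair_rankOne (x y : E) : AdjointPair A (rankOne A x y) (rankOne A y x) :=
  fun z w => by
    change inner A (inner A y z • x) w = inner A z (inner A x w • y)
    rw [inner_op_smul_left, inner_op_smul_right, star_inner]

theorem compactOperators_mul {K V : E →L[ℂ] E} (hK : K ∈ compactOperators A E)
    (hV : IsAdjointable A V) : K * V ∈ compactOperators A E := by
  obtain ⟨W, hW⟩ := hV
  let r : (E →L[ℂ] E) →L[ℂ] (E →L[ℂ] E) := (ContinuousLinearMap.mul ℂ (E →L[ℂ] E)).flip V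
  refine map_mem_closure (f := r) r.continuous hK fun F hF => ?_
  refine Submodule.span_le (p := (Submodule.span ℂ _).comap (r : (E →L[ℂ] E) →ₗ[ℂ] (E →L[ℂ] E))).2
    ?_ hF
  rintro _ ⟨x, y, rfl⟩
  -- Here `θ_{x,y} V = θ_{x,V*y}`, with `W = V*`.
  refine Submodule.subset_span ⟨x, W y, ?_⟩
  ext z
  change inner A y (V z) • x = inner A (W y) z • x
  rw [AdjointPair.symm hW]

theorem exists_adjointPair_of_mem_span {F : E →L[ℂ] E}
    (hF : F ∈ Submodule.span ℂ {T : E →L[ℂ] E | ∃ x y : E, T = rankOne A x y}) :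
    ∃ H ∈ Submodule.span ℂ {T : E →L[ℂ] E | ∃ x y : E, T = rankOne A x y}, AdjointPair A F H := by
  induction hF using Submodule.span_induction with
  | mem F hF =>
    obtain ⟨x, y, rfl⟩ := hF
    exact ⟨_, Submodule.subset_span ⟨y, x, rfl⟩, adjointPair_rankOne x y⟩
  | zero => exact ⟨0, zero_mem _, .zero⟩
  | add F G _ _ hF hG =>
    obtain ⟨F', hF', h⟩ := hF
    obtain ⟨G', hG', h'⟩ := hG
    exact ⟨F' + G', add_mem hF' hG', h.add h'⟩
  | smul c F _ hF =>
    obtain ⟨F', hF', h⟩ := hF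
    exact ⟨star c • F', Submodule.smul_mem _ _ hF', h.smul c⟩

/-- The adjoint of a compact operator is compact. -/
theorem AdjointPair.mem_compactOperators {K L : E →L[ℂ] E} (h : AdjointPair A K L)
    (hK : K ∈ compactOperators A E) : L ∈ compactOperators A E := by
  refine Metric.mem_closure_iff.2 fun ε hε => ?_
  obtain ⟨F, hF, hd⟩ := Metric.mem_closure_iff.1 hK ε hε
  obtain ⟨H, hH, hFH⟩ := exists_adjointPair_of_mem_span hF
  refine ⟨H, hH, ?_⟩
  rw [dist_eq_norm] at hd ⊢
  exact (h.sub hFH).norm_le.trans_lt hd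

/-! ### Closures of partially defined bounded operators -/

theorem toPMap_top_isClosed (T : E →L[ℂ] E) : ((T : E →ₗ[ℂ] E).toPMap ⊤).IsClosed := by
  have h : (((T : E →ₗ[ℂ] E).toPMap ⊤).graph : Set (E × E)) = {p | T p.1 = p.2} := by
    ext ⟨x, y⟩
    simp
  rw [LinearPMap.IsClosed, h]
  exact isClosed_eq (by fun_prop) (by fun_prop)

/-- The graph of `u` is dense in that of `T`, because `z ↦ (z, T z)` is continuous. -/
theorem isClosable_and_closure_eq_of_le {u : E →ₗ.[ℂ] E} {T : E →L[ℂ] E}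
    (hu : Dense (u.domain : Set E)) (h : u ≤ (T : E →ₗ[ℂ] E).toPMap ⊤) :
    u.IsClosable ∧ u.closure = (T : E →ₗ[ℂ] E).toPMap ⊤ := by
  have hcl := (toPMap_top_isClosed T).isClosable.leIsClosable h
  refine ⟨hcl, LinearPMap.eq_of_eq_graph ?_⟩
  rw [← hcl.graph_closure_eq_closure_graph]
  refine le_antisymm (Submodule.topologicalClosure_minimal _ (LinearPMap.le_graph_of_le h)
    (toPMap_top_isClosed T)) ?_
  rintro ⟨x, y⟩ hxy
  obtain rfl : T x = y := by simpa using hxy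
  refine map_mem_closure (f := fun z => (z, T z)) (by fun_prop) (hu x) fun z hz => ?_
  have : u ⟨z, hz⟩ = T z := h.2 (y := ⟨z, trivial⟩) rfl
  change (z, T z) ∈ u.graph
  rw [← this]
  exact u.mem_graph ⟨z, hz⟩

theorem closureEqOneModCompact_of_le {u : E →ₗ.[ℂ] E} {T : E →L[ℂ] E}
    (hu : Dense (u.domain : Set E)) (h : u ≤ (T : E →ₗ[ℂ] E).toPMap ⊤)
    (hT : IsAdjointable A T) (hK : T - 1 ∈ compactOperators A E) :
    ClosureEqOneModCompact A u :=
  have hc := isClosable_and_closure_eq_of_le hu h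
  ⟨hc.1, T, hT, hc.2, hK⟩

/-- For a closed operator `t`, a pseudo right inverse `G` maps into the domain of `t`. -/
theorem IsPseudoRightInverse.exists_graph {t : E →ₗ.[ℂ] E} (ht : t.IsClosed) {G : E →L[ℂ] E}
    (hG : IsPseudoRightInverse A G t) :
    ∃ T : E →L[ℂ] E, IsAdjointable A T ∧ T - 1 ∈ compactOperators A E ∧
      ∀ x, (G x, T x) ∈ t.graph := by
  obtain ⟨-, hcl, T, hT, hTc, hK⟩ := hG
  refine ⟨T, hT, hK, fun x => ?_⟩
  have hx : (x, T x) ∈ (pcomp t ((G : E →ₗ[ℂ] E).toPMap ⊤)).graph.topologicalClosure := by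
    rw [hcl.graph_closure_eq_closure_graph, hTc]
    simp
  -- The map `(x, y) ↦ (G x, y)` sends the graph of `t G` into that of `t`, which is closed.
  have := map_mem_closure (f := fun p : E × E => (G p.1, p.2)) (by fun_prop) hx
    (t := t.graph) fun p hp => ?_
  · rwa [ht.closure_eq] at this
  · obtain ⟨⟨y, hy⟩, rfl⟩ := (LinearPMap.mem_graph_iff' _).1 hp
    obtain ⟨h1, h2⟩ := mem_pcomp_domain.1 hy
    exact t.mem_graph ⟨_, h2⟩

theorem isPseudoRightInverse_of_graph {t : E →ₗ.[ℂ] E} {G T : E →L[ℂ] E}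
    (hG : IsAdjointable A G) (hT : IsAdjointable A T) (hK : T - 1 ∈ compactOperators A E)
    (h : ∀ x, (G x, T x) ∈ t.graph) : IsPseudoRightInverse A G t := by
  refine ⟨hG, closureEqOneModCompact_of_le (T := T) ?_ ⟨fun _ _ => trivial, ?_⟩ hT hK⟩
  · refine dense_univ.mono fun x _ => ?_
    exact mem_pcomp_domain.2 ⟨trivial, LinearPMap.mem_domain_of_mem_graph (h x)⟩
  · rintro ⟨x, hx⟩ ⟨_, _⟩ rfl
    obtain ⟨h1, h2⟩ := mem_pcomp_domain.1 hx
    exact t.mem_graph_snd_inj (t.mem_graph ⟨_, h2⟩) (h x) rfl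

/-! ### Selfadjoint regular operators -/

theorem IsSelfAdjointRegular.graph_eq {t : E →ₗ.[ℂ] E} (ht : IsSelfAdjointRegular A t) :
    t.graph = adjointGraph A t := by
  rw [← graph_adjoint A ht.isRegular.dense_domain, ht.adjoint_eq]

theorem IsSelfAdjointRegular.isSymm {t : E →ₗ.[ℂ] E} (ht : IsSelfAdjointRegular A t) :
    IsSymm A t := fun x y => by
  have h := t.mem_graph y
  rw [ht.graph_eq] at h
  exact h x

/-- The adjoint of a pseudo right inverse of a symmetric operator is a pseudo left inverse. -/
theorem isPseudoLeftInverse_of_graph {t : E →ₗ.[ℂ] E} (ht : IsSymm A t)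
    (hd : Dense (t.domain : Set E)) {G H T S : E →L[ℂ] E} (hG : AdjointPair A G H)
    (hT : AdjointPair A T S) (hK : T - 1 ∈ compactOperators A E)
    (h : ∀ x, (G x, T x) ∈ t.graph) : IsPseudoLeftInverse A H t := by
  refine ⟨hG.symm.isAdjointable, closureEqOneModCompact_of_le (T := S) ?_
    ⟨fun _ _ => trivial, ?_⟩ hT.symm.isAdjointable
    ((hT.sub .one).mem_compactOperators hK)⟩
  · exact hd.mono fun x hx => mem_pcomp_domain.2 ⟨hx, trivial⟩
  · rintro ⟨x, hx⟩ ⟨_, _⟩ rfl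
    obtain ⟨h1, h2⟩ := mem_pcomp_domain.1 hx
    change H (t ⟨x, h1⟩) = S x
    -- `⟪z, H t x⟫ = ⟪G z, t x⟫ = ⟪t G z, x⟫ = ⟪T z, x⟫ = ⟪z, S x⟫`.
    refine ext_inner (A := A) fun z => ?_
    obtain ⟨w, hw, hw'⟩ := (LinearPMap.mem_graph_iff _).1 (h z)
    simp only at hw hw'
    rw [← hG, ← hT, ← hw, ← hw', ← ht]

theorem IsSymm.norm_le {t : E →ₗ.[ℂ] E} (ht : IsSymm A t) {c : ℂ}
    (hc : star c = -c) (hc2 : c * c = -1) (x : t.domain) :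
    ‖(x : E)‖ ≤ ‖t x + c • (x : E)‖ ∧ ‖t x‖ ≤ ‖t x + c • (x : E)‖ := by
  constructor <;> refine le_of_sq_le_sq ?_ (norm_nonneg _) <;>
    rw [norm_sq_eq A, norm_sq_eq A, ht.inner_self_add_smul hc hc2]
  · exact CStarAlgebra.norm_le_norm_of_nonneg_of_le inner_self_nonneg
      (le_add_of_nonneg_left inner_self_nonneg)
  · exact CStarAlgebra.norm_le_norm_of_nonneg_of_le inner_self_nonneg
      (le_add_of_nonneg_right inner_self_nonneg)

/-- If `t` is selfadjoint and regular, then `t ± i` is surjective. -/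
theorem IsSelfAdjointRegular.exists_add_smul_eq [CompleteSpace E] {t : E →ₗ.[ℂ] E}
    (ht : IsSelfAdjointRegular A t) {c : ℂ} (hc : star c = -c) (hc2 : c * c = -1) (y : E) :
    ∃ x : t.domain, t x + c • (x : E) = y := by
  -- Viewed on the graph, which is complete, `t + c` is continuous and bounded below, so its range
  -- is closed.
  let φ : t.graph →L[ℂ] E :=
    (ContinuousLinearMap.snd ℂ E E + c • ContinuousLinearMap.fst ℂ E E) ∘L t.graph.subtypeL
  have hφ : ∀ x : t.domain, φ ⟨_, t.mem_graph x⟩ = t x + c • (x : E) := fun x => rfl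
  have hanti : AntilipschitzWith 1 φ := by
    refine AddMonoidHomClass.antilipschitz_of_bound φ ?_
    rintro ⟨p, hp⟩
    obtain ⟨x, rfl⟩ := (LinearPMap.mem_graph_iff' _).1 hp
    rw [NNReal.coe_one, one_mul, hφ]
    have := ht.isSymm.norm_le hc hc2 x
    exact max_le this.1 this.2
  have : CompleteSpace t.graph := IsClosed.completeSpace_coe (hs := ht.isRegular.isClosed)
  have hcl : _root_.IsClosed (Set.range φ) := hanti.isClosed_range φ.uniformContinuous
  have hdense : Dense (Set.range φ) := by
    have h := ht.isRegular.dense_range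
    rw [ht.adjoint_eq] at h
    refine h.mono ?_
    rintro _ ⟨⟨x, hx⟩, rfl⟩
    obtain ⟨h1, h2⟩ := mem_pcomp_domain.1 hx
    -- Since `c² = -1`, `(t + c)(t - c) x = t² x + x`: the range of `t + c` contains the dense range
    -- of `1 + t* t`.
    refine ⟨⟨_, t.mem_graph (⟨t ⟨x, h1⟩, h2⟩ - c • ⟨x, h1⟩)⟩, ?_⟩
    rw [hφ, t.map_sub, t.map_smul]
    change _ = x + t ⟨t ⟨x, h1⟩, h2⟩
    simp only [Submodule.coe_sub, Submodule.coe_smul, smul_sub, smul_smul, hc2, neg_smul, one_smul]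
    abel
  obtain ⟨⟨p, hp⟩, h⟩ : y ∈ Set.range φ := by
    rw [← hcl.closure_eq]
    exact hdense y
  obtain ⟨x, rfl⟩ := (LinearPMap.mem_graph_iff' _).1 hp
  exact ⟨x, h⟩

/-- A densely defined symmetric module map `t` with `t ± i` surjective is selfadjoint regular. -/
theorem IsSymm.isSelfAdjointRegular {t : E →ₗ.[ℂ] E} (ht : IsSymm A t) (hA : IsModuleMap A t)
    (hd : Dense (t.domain : Set E))
    (hs : ∀ c : ℂ, star c = -c → c * c = -1 → ∀ y, ∃ x : t.domain, t x + c • (x : E) = y) :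
    IsSelfAdjointRegular A t := by
  have hI : star Complex.I = -Complex.I := Complex.conj_I
  have hI' : star (-Complex.I) = -(-Complex.I) := by rw [star_neg, hI]
  have hgraph : t.graph = adjointGraph A t := by
    refine le_antisymm ?_ ?_
    · intro p hp
      obtain ⟨x, rfl⟩ := (LinearPMap.mem_graph_iff' _).1 hp
      exact fun y => ht y x
    · rintro ⟨y, z⟩ hp
      -- Solve `(t + i) w = z + i y`; then `y - w` is orthogonal to the range of `t - i`, which is
      -- all of `E`.
      obtain ⟨w, hw⟩ := hs _ hI Complex.I_mul_I (z + Complex.I • y)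
      have hyw : y = w := by
        refine ext_inner (A := A) fun v => ?_
        obtain ⟨x, rfl⟩ := hs _ hI' (by simp) v
        have h1 : inner A (t x) y = inner A (x : E) z := hp x
        rw [CStarModule.inner_add_left, CStarModule.inner_add_left, h1, ht, inner_smul_left_complex,
          inner_smul_left_complex, hI', neg_neg, ← inner_smul_right_complex,
          ← inner_smul_right_complex, ← CStarModule.inner_add_right, ← CStarModule.inner_add_right, hw]
      subst hyw
      rw [← add_right_cancel hw]
      exact t.mem_graph w
  have hadj : adjoint A t = t := LinearPMap.eq_of_eq_graph <| by
    rw [graph_adjoint A hd, hgraph]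
  refine ⟨⟨hA, ?_, hd, by rwa [hadj], ?_⟩, hadj⟩
  · rw [LinearPMap.IsClosed, hgraph]
    change _root_.IsClosed {p : E × E | ∀ x : t.domain, inner A (t x) p.1 = inner A (x : E) p.2}
    rw [Set.ofPred_forall]
    refine isClosed_iInter fun x => isClosed_eq ?_ ?_
    · exact (continuous_inner (A := A)).comp (continuous_const.prodMk continuous_fst)
    · exact (continuous_inner (A := A)).comp (continuous_const.prodMk continuous_snd)
  · rw [hadj]
    refine dense_univ.mono fun y _ => ?_
    -- Factor `1 + t² = (t - i)(t + i)` and solve one factor at a time.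
    obtain ⟨v, hv⟩ := hs _ hI' (by simp) y
    obtain ⟨w, hw⟩ := hs _ hI Complex.I_mul_I (v : E)
    have hw' : t w = ((v - Complex.I • w : t.domain) : E) := by
      rw [Submodule.coe_sub, Submodule.coe_smul, ← hw, add_sub_cancel_right]
    have hm : t w ∈ t.domain := hw' ▸ (v - Complex.I • w).2
    refine ⟨⟨w, mem_pcomp_domain.2 ⟨w.2, hm⟩⟩, ?_⟩
    change (w : E) + t ⟨t w, hm⟩ = y
    have : (⟨t w, hm⟩ : t.domain) = v - Complex.I • w := Subtype.ext hw'
    rw [this, t.map_sub, t.map_smul, hw', ← hv]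
    simp only [Submodule.coe_sub, Submodule.coe_smul, smul_sub, smul_smul, Complex.I_mul_I,
      neg_smul, one_smul]
    abel

/-! ### Products of an unbounded and a bounded operator -/

/-- If `B` is bounded with range in `D(s)` and `s B` is bounded, then `s B` is a bounded operator. -/
theorem exists_mul_of_bound {s : E →ₗ.[ℂ] E} {B : E →ₗ[ℂ] E} (hB : ∀ x, B x ∈ s.domain)
    {C : ℝ} (hC : 0 ≤ C) (h : ∀ x, ‖s ⟨B x, hB x⟩‖ ≤ C * ‖x‖) :
    ∃ S : E →L[ℂ] E, ‖S‖ ≤ C ∧ ∀ x, S x = s ⟨B x, hB x⟩ :=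
  ⟨LinearMap.mkContinuous (s.toFun ∘ₗ B.codRestrict s.domain hB) C h,
    LinearMap.mkContinuous_norm_le _ hC _, fun _ => rfl⟩

/-- If `s` is symmetric and densely defined, `B` is adjointable and `s B` is bounded, then `s B` is
adjointable. -/
theorem IsSymm.isAdjointable_mul [CompleteSpace E] {s : E →ₗ.[ℂ] E} (hs : IsSymm A s)
    (hd : Dense (s.domain : Set E)) {B S : E →L[ℂ] E} (hB : IsAdjointable A B)
    (h : ∀ x, (B x, S x) ∈ s.graph) : IsAdjointable A S := by
  obtain ⟨D, hD⟩ := hB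
  have key : ∀ (x : E) (y : s.domain), inner A (S x) (y : E) = inner A x (D (s y)) := fun x y => by
    obtain ⟨w, hw, hw'⟩ := (LinearPMap.mem_graph_iff _).1 (h x)
    simp only at hw hw'
    rw [← hD, ← hw, ← hw', hs]
  -- By `key`, `B* s` is bounded by `‖S‖` on the dense domain of `s`; its continuous extension is
  -- the adjoint of `S`.
  let f : s.domain →L[ℂ] E := LinearMap.mkContinuous ((D : E →ₗ[ℂ] E) ∘ₗ s.toFun) ‖S‖ fun y => by
    change ‖D (s y)‖ ≤ ‖S‖ * ‖(y : E)‖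
    refine norm_le_of_norm_inner_le (A := A) (by positivity) ?_
    rw [← key]
    calc _ ≤ ‖S (D (s y))‖ * ‖(y : E)‖ := norm_inner_le E
      _ ≤ ‖S‖ * ‖D (s y)‖ * ‖(y : E)‖ := by gcongr; exact S.le_opNorm _
      _ = _ := by ring
  have hdr : DenseRange s.domain.subtypeL := by
    change Dense (Set.range ((↑) : s.domain → E))
    rwa [Subtype.range_coe]
  have hf : ∀ y : s.domain, f.extend s.domain.subtypeL (y : E) = D (s y) := fun y =>
    f.extend_eq (e := s.domain.subtypeL) hdr isometry_subtype_coe.isUniformInducing y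
  refine ⟨f.extend s.domain.subtypeL, fun x => ?_⟩
  refine congrFun (Continuous.ext_on hd (f := fun y => inner A (S x) y)
    (g := fun y => inner A x (f.extend s.domain.subtypeL y)) ?_ ?_ fun y hy => ?_)
  · exact (continuous_inner (A := A)).comp (continuous_const.prodMk continuous_id)
  · exact (continuous_inner (A := A)).comp
      (continuous_const.prodMk (ContinuousLinearMap.continuous _))
  · exact (key x ⟨y, hy⟩).trans (congrArg (inner A x) (hf ⟨y, hy⟩).symm)

theorem exists_inverse_one_add [CompleteSpace E] {S : E →L[ℂ] E} (hS : ‖S‖ < 1) :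
    ∃ V : E →L[ℂ] E, (1 + S) * V = 1 :=
  let u := Units.oneSub (-S) (by rwa [norm_neg])
  ⟨(u⁻¹ : (E →L[ℂ] E)ˣ), by rw [← sub_neg_eq_add]; exact u.mul_inv⟩

/-- The adjoint `S'` also has norm below one, and the inverse of `1 + S'` is the adjoint of that of
`1 + S`. -/
theorem exists_adjointable_inverse_one_add [CompleteSpace E] {S : E →L[ℂ] E} (hS : ‖S‖ < 1)
    (hA : IsAdjointable A S) : ∃ V : E →L[ℂ] E, IsAdjointable A V ∧ (1 + S) * V = 1 := by
  obtain ⟨S', hS'⟩ := hA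
  obtain ⟨V, hV⟩ := exists_inverse_one_add hS
  obtain ⟨V', hV'⟩ := exists_inverse_one_add ((AdjointPair.norm_le hS').trans_lt hS)
  exact ⟨V, ((AdjointPair.one.add hS').of_inverse hV hV').isAdjointable, hV⟩

/-! ### Sums -/

theorem add_mem_graph {t s : E →ₗ.[ℂ] E} {x y z : E} (h : (x, y) ∈ t.graph)
    (h' : (x, z) ∈ s.graph) : (x, y + z) ∈ (t + s).graph := by
  obtain ⟨⟨x, h1⟩, rfl, rfl⟩ := (LinearPMap.mem_graph_iff _).1 h
  obtain ⟨⟨_, h2⟩, rfl, rfl⟩ := (LinearPMap.mem_graph_iff _).1 h'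
  exact (t + s).mem_graph ⟨_, h1, h2⟩

/-- **Kato–Rellich theorem** for selfadjoint regular operators. -/
theorem IsSelfAdjointRegular.add [CompleteSpace E] {t s : E →ₗ.[ℂ] E}
    (ht : IsSelfAdjointRegular A t) (hs : IsSelfAdjointRegular A s) (hD : t.domain ≤ s.domain)
    {δ : ℝ} (hδ0 : 0 ≤ δ) (hδ : 2 * δ < 1)
    (hb : ∀ x : t.domain, ‖s ⟨x, hD x.2⟩‖ ≤ δ * (‖t x‖ + ‖(x : E)‖)) :
    IsSelfAdjointRegular A (t + s) := by
  refine (ht.isSymm.add hs.isSymm).isSelfAdjointRegular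
    (ht.isRegular.isModuleMap.add hs.isRegular.isModuleMap) ?_ fun c hc hc2 y => ?_
  · exact ht.isRegular.dense_domain.mono fun x hx => ⟨hx, hD hx⟩
  · let L : t.domain →ₗ[ℂ] E := t.toFun + c • t.domain.subtype
    have hL : ∀ x, L x = t x + c • (x : E) := fun x => rfl
    have hbij : Function.Bijective L := by
      refine ⟨(injective_iff_map_eq_zero L).2 fun x hx => ?_, ht.exists_add_smul_eq hc hc2⟩
      have := (ht.isSymm.norm_le hc hc2 x).1
      rw [← hL, hx, norm_zero] at this
      exact Subtype.ext (norm_le_zero_iff.1 this)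
    let e := LinearEquiv.ofBijective L hbij
    have he : ∀ y, t (e.symm y) + c • (e.symm y : E) = y := e.apply_symm_apply
    obtain ⟨S, hSn, hS⟩ := exists_mul_of_bound (s := s)
      (B := t.domain.subtype ∘ₗ (e.symm : E →ₗ[ℂ] t.domain)) (fun y => hD (e.symm y).2)
      -- The factor 2 arises because `‖t x‖` and `‖x‖` are each at most `‖y‖` when `x = (t + c)⁻¹
      -- y`.
      (C := 2 * δ) (by positivity) fun y => by
        refine (hb (e.symm y)).trans ?_
        have h := ht.isSymm.norm_le hc hc2 (e.symm y)
        rw [he] at h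
        nlinarith [h.1, h.2]
    obtain ⟨V, hV⟩ := exists_inverse_one_add (hSn.trans_lt hδ)
    refine ⟨⟨e.symm (V y), (e.symm (V y)).2, hD (e.symm (V y)).2⟩, ?_⟩
    have h1 : V y + S (V y) = y := congr($hV y)
    rw [hS] at h1
    rw [LinearPMap.add_apply, add_right_comm]
    refine Eq.trans ?_ h1
    exact congrArg (· + _) (he (V y))

end Lemmas

end HilbertCStarModule

/-! ### Stability of the Fredholm property -/

open HilbertCStarModule in
theorem mainTheorem3 {A E : Type*} [NonUnitalCStarAlgebra A] [PartialOrder A] [StarOrderedRing A]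
    [NormedAddCommGroup E] [NormedSpace ℂ E] [SMul A E] [CStarModule A E] [CompleteSpace E]
    (t : E →ₗ.[ℂ] E) (ht : HilbertCStarModule.IsSelfAdjointRegular A t)
    (htF : HilbertCStarModule.IsFredholm A t) :
    ∃ ε : ℝ, 0 < ε ∧ ∀ s : E →ₗ.[ℂ] E, HilbertCStarModule.IsSelfAdjointRegular A s →
      ∀ hD : t.domain ≤ s.domain,
        (∀ x : t.domain, ‖s ⟨x, hD x.2⟩‖ ≤ ε * (‖t x + s ⟨x, hD x.2⟩‖ + ‖(x : E)‖)) →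
          HilbertCStarModule.IsSelfAdjointRegular A (t + s) ∧
            HilbertCStarModule.IsFredholm A (t + s) := by
  obtain ⟨G, hG⟩ := htF.exists_right
  obtain ⟨T, hT, hK, hgr⟩ := hG.exists_graph ht.isRegular.isClosed
  -- The bound `2δ < 1` serves Kato–Rellich; the last one makes `1 + s G` invertible.
  obtain ⟨δ, hδ0, hδ, hδC⟩ : ∃ δ : ℝ, 0 < δ ∧ 2 * δ < 1 ∧ δ * (‖T‖ + ‖G‖) < 1 := by
    have h0 : 0 ≤ ‖T‖ + ‖G‖ := by positivity
    refine ⟨1 / (3 + (‖T‖ + ‖G‖)), by positivity, ?_, ?_⟩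
    · rw [mul_one_div, div_lt_one (by positivity)]
      linarith
    · rw [one_div_mul_eq_div, div_lt_one (by positivity)]
      linarith
  -- With this `ε`, the hypothesis reads `(1 + δ)‖s x‖ ≤ δ (‖t x + s x‖ + ‖x‖)`; the triangle
  -- inequality then cancels `δ ‖s x‖`.
  refine ⟨δ / (1 + δ), by positivity, fun s hs hD hb' => ?_⟩
  have hb : ∀ x : t.domain, ‖s ⟨x, hD x.2⟩‖ ≤ δ * (‖t x‖ + ‖(x : E)‖) := fun x => by
    have h1 := hb' x
    rw [div_mul_eq_mul_div, le_div_iff₀ (by positivity)] at h1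
    have h2 := mul_le_mul_of_nonneg_left (norm_add_le (t x) (s ⟨x, hD x.2⟩)) hδ0.le
    linarith
  have hsa := ht.add hs hD hδ0.le hδ hb
  have hGt : ∀ x, G x ∈ t.domain := fun x => LinearPMap.mem_domain_of_mem_graph (hgr x)
  obtain ⟨S, hSn, hS⟩ := exists_mul_of_bound (s := s) (B := (G : E →ₗ[ℂ] E))
    (fun x => hD (hGt x)) (C := δ * (‖T‖ + ‖G‖)) (by positivity) fun x => by
      refine (hb ⟨G x, hGt x⟩).trans ?_
      have h1 : t ⟨G x, hGt x⟩ = T x :=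
        t.mem_graph_snd_inj (t.mem_graph ⟨G x, hGt x⟩) (hgr x) rfl
      rw [h1, mul_assoc, add_mul]
      gcongr
      · exact T.le_opNorm x
      · exact G.le_opNorm x
  have hSgr : ∀ x, (G x, S x) ∈ s.graph := fun x => by
    rw [hS]
    exact s.mem_graph ⟨G x, hD (hGt x)⟩
  have hSA : IsAdjointable A S :=
    hs.isSymm.isAdjointable_mul hs.isRegular.dense_domain hG.1 hSgr
  obtain ⟨V, hVA, hV⟩ := exists_adjointable_inverse_one_add (hSn.trans_lt hδC) hSA
  have hsum : ∀ x, ((G * V) x, ((T + S) * V) x) ∈ (t + s).graph := fun x =>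
    add_mem_graph (hgr (V x)) (hSgr (V x))
  have hcompact : (T + S) * V - 1 ∈ compactOperators A E := by
    -- Write `T + S = (T - 1) + (1 + S)` and use `(1 + S) V = 1`.
    have : (T + S) * V - 1 = (T - 1) * V := by
      rw [sub_mul, one_mul, sub_eq_sub_iff_add_eq_add, ← hV]
      noncomm_ring
    rw [this]
    exact compactOperators_mul hK hVA
  obtain ⟨G', hG'⟩ := hG.1
  obtain ⟨T', hT'⟩ := hT
  obtain ⟨S', hS'⟩ := hSA
  obtain ⟨V', hV'⟩ := hVA
  have hGV := AdjointPair.mul hG' hV'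
  have hTV := (AdjointPair.add hT' hS').mul hV'
  exact ⟨hsa, hsa.isRegular,
    ⟨_, isPseudoLeftInverse_of_graph hsa.isSymm hsa.isRegular.dense_domain hGV hTV hcompact hsum⟩,
    ⟨_, isPseudoRightInverse_of_graph hGV.isAdjointable hTV.isAdjointable hcompact hsum⟩⟩
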